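/- Let $\mathbb{D}=\{z\in\mathbb{C}:|z|<1\}$ and let $\mathcal{A}$ be the class of analytic functions $f$ in $\mathbb{D}$ with Taylor series $f(z)=z+\sum_{n=2}^{\infty}a_nz^n$. Let $\mathcal{S}^*$ be the class of functions $g\in\mathcal{A}$ that are one-to-one in $\mathbb{D}$ and whose image $g(\mathbb{D})$ is starlike with respect to the origin, i.e. $tw\in g(\mathbb{D})$ whenever $w\in g(\mathbb{D})$ and $0\le t\le 1$. A function $f\in\mathcal{A}$ is called close-to-convex, written $f\in\mathcal{K}$, if there exist $g\in\mathcal{S}^*$ and a real number $\alpha\in(-\pi/2,\pi/2)$ such that $$\operatorname{Re}\left(e^{i\alpha}\frac{zf'(z)}{g(z)}\right)>0\qquad(z\in\mathbb{D}),$$ where the quotient $zf'(z)/g(z)$ is given its limiting value $1$ at $z=0$. **Theorem.** Let $f\in\mathcal{K}$, $f(z)=z+\sum_{n=2}^{\infty}a_nz^n$. Then the symmetric Toeplitz determinant $$T_3(2)=\begin{vmatrix}a_2&a_3&a_4\\a_3&a_2&a_3\\a_4&a_3&a_2\end{vmatrix}$$ satisfies $|T_3(2)|\le 86$. -/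

import Mathlib

/-- The open unit disk in the complex plane. -/
def unitDisk : Set ℂ := Metric.ball (0 : ℂ) 1

/-- The `n`-th Taylor coefficient of `f` at the origin. -/
noncomputable def taylorCoeff (f : ℂ → ℂ) (n : ℕ) : ℂ :=
  iteratedDeriv n f 0 / (n.factorial : ℂ)

/-- The class `𝒜`: analytic functions in the unit disk with Taylor series
`f(z) = z + ∑_{n ≥ 2} a_n z ^ n`. Only the values of `f` on the disk matter. -/
structure IsNormalizedAnalytic (f : ℂ → ℂ) : Prop where
  analytic : AnalyticOnNhd ℂ f unitDisk
  map_zero : f 0 = 0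
  deriv_zero : deriv f 0 = 1

/-- The class `𝒮*`: functions `g` in `𝒜` that are univalent in the unit disk and whose image
domain is starlike with respect to the origin. -/
structure IsStarlike (g : ℂ → ℂ) : Prop where
  normalized : IsNormalizedAnalytic g
  univalent : Set.InjOn g unitDisk
  starlike : ∀ w ∈ g '' unitDisk, ∀ t : ℝ, 0 ≤ t → t ≤ 1 → (t : ℂ) * w ∈ g '' unitDisk

/-- The class `𝒦` of close-to-convex functions: `f` is in `𝒜` and there are `g` in `𝒮*` and
`α ∈ (-π/2, π/2)` with `Re (e^{iα} z f'(z) / g(z)) > 0` in the unit disk.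
At `z = 0` the quotient has a removable singularity with value `1`, where the condition reads
`cos α > 0` and holds for every such `α`; the condition is therefore written for `z ≠ 0`
(where `g z ≠ 0` because `g` is univalent with `g 0 = 0`). -/
def IsCloseToConvex (f : ℂ → ℂ) : Prop :=
  IsNormalizedAnalytic f ∧
    ∃ g : ℂ → ℂ, IsStarlike g ∧
      ∃ α ∈ Set.Ioo (-(Real.pi / 2)) (Real.pi / 2),
        ∀ z ∈ unitDisk, z ≠ 0 →
          0 < (Complex.exp (Complex.I * (α : ℂ)) * (z * deriv f z / g z)).re

/-- The symmetric Toeplitz determinant `T_q(n)` of the Taylor coefficients of `f`: the determinant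
of the `q × q` matrix whose `(i, j)` entry is `a_{n + |i - j|}`. -/
noncomputable def toeplitzDet (f : ℂ → ℂ) (q n : ℕ) : ℂ :=
  Matrix.det (Matrix.of fun i j : Fin q =>
    taylorCoeff f (n + ((i : ℤ) - (j : ℤ)).natAbs))

/-! The determinant factors as `(a₂ - a₄) * (a₂² - 2a₃² + a₂a₄)`. The factors are bounded by 6 and
14, which gives 84; the function `z/(1 - iz)²` attains this value.

Write `g = zG`, `q = zg'/g = g'/G` and `p = zf'/g = f'/G`. Starlikeness gives `Re q ≥ 0`
(`IsStarlike.re_nonneg`), and `e^{iα} p` has nonnegative real part by hypothesis. Carathéodory's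
inequality bounds the coefficients of both by 2, and comparing coefficients in `g' = qG` and `f' =
pG` yields `|a₂| ≤ 2` and `|a₄| ≤ 4`.

The quadratic factor needs more than these moduli. A Möbius map turns `q` and `p` into self-maps of
the disk with coefficients `s, s₁, s₂` and `t, t₁, t₂` (`exists_schur_coeffs`). The angle enters
only through `l = cos α · e^{-iα}`, a point of the circle `|l|² = Re l`. The factor becomes a
polynomial in these seven numbers. The triangle inequality, with powers of `l` combined where
cancellation matters, reduces it to the real estimate `majorant_le`. -/

/-! ### Algebra of Taylor coefficients. -/

lemma taylorCoeff_zero (f : ℂ → ℂ) : taylorCoeff f 0 = f 0 := by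
  simp [taylorCoeff]

lemma taylorCoeff_congr {f g : ℂ → ℂ} (h : f =ᶠ[nhds 0] g) (n : ℕ) :
    taylorCoeff f n = taylorCoeff g n := by
  simp only [taylorCoeff, h.iteratedDeriv_eq n]

lemma taylorCoeff_deriv (f : ℂ → ℂ) (n : ℕ) :
    taylorCoeff (deriv f) n = (n + 1) * taylorCoeff f (n + 1) := by
  simp only [taylorCoeff, iteratedDeriv_succ', Nat.factorial_succ]
  have h : (n.factorial : ℂ) ≠ 0 := by exact_mod_cast n.factorial_ne_zero
  have h' : (n : ℂ) + 1 ≠ 0 := by exact_mod_cast n.succ_ne_zero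
  push_cast
  field_simp

lemma taylorCoeff_const (c : ℂ) (n : ℕ) :
    taylorCoeff (fun _ => c) n = if n = 0 then c else 0 := by
  rcases n with _ | n <;> simp [taylorCoeff, iteratedDeriv_const]

lemma taylorCoeff_add {f g : ℂ → ℂ} (hf : AnalyticAt ℂ f 0) (hg : AnalyticAt ℂ g 0) (n : ℕ) :
    taylorCoeff (fun z => f z + g z) n = taylorCoeff f n + taylorCoeff g n := by
  simp only [taylorCoeff, iteratedDeriv_fun_add hf.contDiffAt hg.contDiffAt, add_div]

lemma taylorCoeff_const_mul {f : ℂ → ℂ} (hf : AnalyticAt ℂ f 0) (c : ℂ) (n : ℕ) :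
    taylorCoeff (fun z => c * f z) n = c * taylorCoeff f n := by
  simp only [taylorCoeff, iteratedDeriv_const_mul c hf.contDiffAt, mul_div_assoc]

lemma taylorCoeff_mul {f g : ℂ → ℂ} (hf : AnalyticAt ℂ f 0) (hg : AnalyticAt ℂ g 0) (n : ℕ) :
    taylorCoeff (fun z => f z * g z) n =
      ∑ i ∈ Finset.range (n + 1), taylorCoeff f i * taylorCoeff g (n - i) := by
  simp only [taylorCoeff, iteratedDeriv_fun_mul hf.contDiffAt hg.contDiffAt, Finset.sum_div]
  refine Finset.sum_congr rfl fun i hi => ?_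
  have hin : i ≤ n := Nat.lt_succ_iff.mp (Finset.mem_range.mp hi)
  rw [Nat.cast_choose ℂ hin]
  have h1 : (n.factorial : ℂ) ≠ 0 := by exact_mod_cast n.factorial_ne_zero
  have h2 : (i.factorial : ℂ) ≠ 0 := by exact_mod_cast i.factorial_ne_zero
  have h3 : ((n - i).factorial : ℂ) ≠ 0 := by exact_mod_cast (n - i).factorial_ne_zero
  field_simp

lemma taylorCoeff_id (n : ℕ) : taylorCoeff (fun z => z) n = if n = 1 then 1 else 0 := by
  rcases n with _ | n
  · simp [taylorCoeff_zero]
  · have h : deriv (fun z : ℂ => z) = fun _ => 1 := by ext; simp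
    simp only [taylorCoeff, iteratedDeriv_succ', h, iteratedDeriv_const]
    rcases n with _ | n <;> simp

lemma taylorCoeff_id_mul {f : ℂ → ℂ} (hf : AnalyticAt ℂ f 0) (n : ℕ) :
    taylorCoeff (fun z => z * f z) (n + 1) = taylorCoeff f n := by
  rw [taylorCoeff_mul (f := fun z => z) analyticAt_id hf, Finset.sum_eq_single 1]
  · simp [taylorCoeff_id]
  · intro i _ hi
    simp [taylorCoeff_id, hi]
  · simp

/-! ### Coefficient bounds from circle averages. -/

lemma isOpen_unitDisk : IsOpen unitDisk := Metric.isOpen_ball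

lemma mem_unitDisk {z : ℂ} : z ∈ unitDisk ↔ ‖z‖ < 1 := by simp [unitDisk]

lemma zero_mem_unitDisk : (0 : ℂ) ∈ unitDisk := by simp [mem_unitDisk]

/-- The Taylor coefficients of a function as circle averages. -/
lemma circleAverage_zpow_mul {H : ℂ → ℂ} {r : ℝ} (hr : 0 < r)
    (hH : DifferentiableOn ℂ H (Metric.closedBall 0 r)) (n : ℕ) :
    Real.circleAverage (fun z => (z ^ n)⁻¹ * H z) 0 r = taylorCoeff H n := by
  have h := hH.circleIntegral_one_div_sub_center_pow_smul hr n
  rw [Real.circleAverage_eq_circleIntegral hr.ne']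
  have : (fun z : ℂ => (z - 0)⁻¹ • ((z ^ n)⁻¹ * H z)) =
      fun z => (1 / (z - 0) ^ (n + 1)) • H z := by
    ext z
    simp only [sub_zero, smul_eq_mul, pow_succ, mul_inv, one_div]
    ring
  rw [this, h, taylorCoeff, smul_smul, smul_eq_mul]
  have := Complex.two_pi_I_ne_zero
  field_simp

lemma circleAverage_pow_mul {H : ℂ → ℂ} {r : ℝ} (hr : 0 < r)
    (hH : DifferentiableOn ℂ H (Metric.closedBall 0 r)) {n : ℕ} (hn : n ≠ 0) :
    Real.circleAverage (fun z => z ^ n * H z) 0 r = 0 := by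
  have h : DifferentiableOn ℂ (fun z => z ^ n * H z) (Metric.closedBall 0 r) := by fun_prop
  have := circleAverage_zpow_mul hr h 0
  simpa [taylorCoeff_zero, hn] using this

lemma exists_norm_eq_one_mul_eq_norm (a : ℂ) : ∃ u : ℂ, ‖u‖ = 1 ∧ u * a = ‖a‖ := by
  rcases eq_or_ne a 0 with h0 | h0
  · exact ⟨1, by simp, by simp [h0]⟩
  · refine ⟨‖a‖ / a, ?_, by field_simp⟩
    rw [norm_div, Complex.norm_real, norm_norm, div_self (norm_ne_zero_iff.mpr h0)]

/-- Averaging `H` against the nonnegative kernel `2 + e + conj e`, where `e = v z⁻ⁿ` is unimodular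
on the circle, gives a nonnegative real part. The average is `2 H(0) + v cₙ`, and the phase of `v`
is chosen so that `v cₙ = -|cₙ| rⁿ`. -/
lemma norm_taylorCoeff_mul_pow_le_of_re_nonneg {H : ℂ → ℂ} {r : ℝ} (hr : 0 < r)
    (hH : DifferentiableOn ℂ H (Metric.closedBall 0 r))
    (hre : ∀ z ∈ Metric.closedBall (0 : ℂ) r, 0 ≤ (H z).re) {n : ℕ} (hn : n ≠ 0) :
    ‖taylorCoeff H n‖ * r ^ n ≤ 2 * (H 0).re := by
  obtain ⟨u, hu, hun⟩ : ∃ u : ℂ, ‖u‖ = 1 ∧ u * taylorCoeff H n = -‖taylorCoeff H n‖ := by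
    obtain ⟨u, hu, hun⟩ := exists_norm_eq_one_mul_eq_norm (taylorCoeff H n)
    exact ⟨-u, by rwa [norm_neg], by rw [neg_mul, hun]⟩
  set v : ℂ := u * r ^ n with hv
  -- On `|z| = r` this makes `w zⁿ` the conjugate of `v z⁻ⁿ`, while `w zⁿ H` is still analytic and
  -- has mean zero.
  set w : ℂ := (starRingEnd ℂ) v * ((r : ℂ) ^ (2 * n))⁻¹ with hw
  clear_value w v
  have hsub : Metric.sphere (0 : ℂ) r ⊆ Metric.closedBall 0 r := Metric.sphere_subset_closedBall
  have hne : ∀ z ∈ Metric.sphere (0 : ℂ) r, z ^ n ≠ 0 := fun z hz =>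
    pow_ne_zero _ (norm_pos_iff.mp (by rw [mem_sphere_zero_iff_norm.mp hz]; exact hr))
  have c1 : ContinuousOn (fun z => (z ^ n)⁻¹ * H z) (Metric.sphere 0 r) :=
    ((continuousOn_pow n).inv₀ hne).mul (hH.continuousOn.mono hsub)
  have c2 : ContinuousOn (fun z => z ^ n * H z) (Metric.sphere 0 r) :=
    (continuousOn_pow n).mul (hH.continuousOn.mono hsub)
  have c3 : ContinuousOn H (Metric.sphere 0 r) := hH.continuousOn.mono hsub
  have i1 : CircleIntegrable (fun z => v * ((z ^ n)⁻¹ * H z)) 0 r :=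
    (continuousOn_const.mul c1).circleIntegrable hr.le
  have i2 : CircleIntegrable (fun z => w * (z ^ n * H z)) 0 r :=
    (continuousOn_const.mul c2).circleIntegrable hr.le
  have i3 : CircleIntegrable (fun z => (2 : ℂ) * H z) 0 r :=
    (continuousOn_const.mul c3).circleIntegrable hr.le
  have i4 : CircleIntegrable (fun z => 2 * H z + v * ((z ^ n)⁻¹ * H z)) 0 r := i3.add i1
  set K : ℂ → ℂ := fun z => 2 * H z + v * ((z ^ n)⁻¹ * H z) + w * (z ^ n * H z) with hK
  have hav : Real.circleAverage K 0 r = 2 * H 0 + v * taylorCoeff H n := by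
    have e0 := circleAverage_zpow_mul hr hH 0
    have e1 := circleAverage_zpow_mul hr hH n
    have e2 := circleAverage_pow_mul hr hH hn
    simp only [pow_zero, inv_one, one_mul, taylorCoeff_zero] at e0
    rw [hK, Real.circleAverage_fun_add i4 i2, Real.circleAverage_fun_add i3 i1]
    have s (a : ℂ) (F : ℂ → ℂ) : Real.circleAverage (fun z => a * F z) 0 r =
        a * Real.circleAverage F 0 r := by
      simpa using Real.circleAverage_fun_smul (a := a) (f := F) (c := 0) (R := r)
    rw [s, s, s, e0, e1, e2, mul_zero, add_zero]
  have hnonneg : 0 ≤ (Real.circleAverage K 0 r).re := by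
    have hKi : CircleIntegrable K 0 r := i4.add i2
    have := Complex.reCLM.circleAverage_comp_comm hKi
    rw [Complex.reCLM_apply] at this
    rw [← this]
    refine Real.circleAverage_nonneg_of_nonneg fun z hz => ?_
    rw [abs_of_pos hr] at hz
    have hzr : ‖z‖ = r := mem_sphere_zero_iff_norm.mp hz
    have hz0 := hne z hz
    set e : ℂ := v * (z ^ n)⁻¹ with he
    have hen : ‖e‖ = 1 := by
      rw [he, hv]
      simp only [norm_mul, norm_inv, norm_pow, hu, hzr, Complex.norm_real, Real.norm_eq_abs,
        abs_of_pos hr, one_mul]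
      exact mul_inv_cancel₀ (pow_ne_zero _ hr.ne')
    have hec : w * z ^ n = (starRingEnd ℂ) e := by
      have hzz : (starRingEnd ℂ) z * z = (r : ℂ) ^ 2 := by
        rw [mul_comm, Complex.mul_conj, Complex.normSq_eq_norm_sq, hzr]; push_cast; rfl
      have hz1 : (starRingEnd ℂ) z ^ n ≠ 0 := by
        rw [← map_pow]; exact (map_ne_zero _).mpr hz0
      rw [he, hw, map_mul, map_inv₀, map_pow, pow_mul, ← hzz, mul_pow]
      field_simp
    have hKe : K z = ((2 + 2 * e.re : ℝ) : ℂ) * H z := by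
      have : ((2 * e.re : ℝ) : ℂ) = e + (starRingEnd ℂ) e := (Complex.add_conj e).symm
      rw [Complex.ofReal_add, this, ← hec, he, hK]
      push_cast
      ring
    simp only [Function.comp, Complex.reCLM_apply, hKe, Complex.re_ofReal_mul]
    refine mul_nonneg ?_ (hre z (hsub hz))
    have := (abs_le.mp (Complex.abs_re_le_norm e)).1
    linarith
  rw [hav] at hnonneg
  have : v * taylorCoeff H n = ((-(‖taylorCoeff H n‖ * r ^ n) : ℝ) : ℂ) := by
    rw [hv, mul_right_comm, hun]; push_cast; ring
  rw [this] at hnonneg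
  simp only [Complex.add_re, Complex.ofReal_re, Complex.mul_re, Complex.re_ofNat,
    Complex.im_ofNat, zero_mul, sub_zero] at hnonneg
  linarith

/-- **Carathéodory's coefficient bound** for functions with nonnegative real part in the disk. -/
theorem norm_taylorCoeff_le_of_re_nonneg {H : ℂ → ℂ} (hH : DifferentiableOn ℂ H unitDisk)
    (hre : ∀ z ∈ unitDisk, 0 ≤ (H z).re) {n : ℕ} (hn : n ≠ 0) :
    ‖taylorCoeff H n‖ ≤ 2 * (H 0).re := by
  have hlim : Filter.Tendsto (fun r : ℝ => ‖taylorCoeff H n‖ * r ^ n)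
      (nhdsWithin 1 (Set.Iio 1)) (nhds (‖taylorCoeff H n‖ * 1 ^ n)) :=
    ((by fun_prop : Continuous fun r : ℝ => ‖taylorCoeff H n‖ * r ^ n).tendsto 1).mono_left
      nhdsWithin_le_nhds
  rw [one_pow, mul_one] at hlim
  refine le_of_tendsto hlim ?_
  filter_upwards [Ioo_mem_nhdsLT (zero_lt_one' ℝ)] with r hr
  have hsub : Metric.closedBall (0 : ℂ) r ⊆ unitDisk := Metric.closedBall_subset_ball hr.2
  exact norm_taylorCoeff_mul_pow_le_of_re_nonneg hr.1 (hH.mono hsub)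
    (fun z hz => hre z (hsub hz)) hn

/-- Coefficient bounds for a self-map of the disk. -/
theorem norm_taylorCoeff_le_of_norm_le_one {s : ℂ → ℂ} (hs : DifferentiableOn ℂ s unitDisk)
    (hb : ∀ z ∈ unitDisk, ‖s z‖ ≤ 1) {n : ℕ} (hn : n ≠ 0) :
    ‖taylorCoeff s n‖ ≤ 1 ∧ ‖taylorCoeff s n‖ ≤ 2 * (1 - ‖s 0‖) := by
  constructor
  · have hlim : Filter.Tendsto (fun r : ℝ => 1 / r ^ n)
        (nhdsWithin 1 (Set.Iio 1)) (nhds (1 / 1 ^ n)) :=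
      (ContinuousAt.tendsto (by fun_prop (disch := simp))).mono_left nhdsWithin_le_nhds
    rw [one_pow, div_one] at hlim
    refine ge_of_tendsto hlim ?_
    filter_upwards [Ioo_mem_nhdsLT (zero_lt_one' ℝ)] with r hr
    have hsub : Metric.closedBall (0 : ℂ) r ⊆ unitDisk := Metric.closedBall_subset_ball hr.2
    have h := Complex.norm_iteratedDeriv_le_of_forall_mem_sphere_norm_le (f := s) (c := 0) (C := 1)
      n hr.1 ((hs.mono hsub).mono Metric.closure_ball_subset_closedBall).diffContOnCl
      (fun z hz => hb z (hsub (Metric.sphere_subset_closedBall hz)))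
    have hf : (0 : ℝ) < n.factorial := by exact_mod_cast n.factorial_pos
    rw [taylorCoeff, norm_div, Complex.norm_natCast, div_le_iff₀ hf]
    calc _ ≤ _ := h
      _ = _ := by ring
  · obtain ⟨u, hu, hua⟩ := exists_norm_eq_one_mul_eq_norm (s 0)
    -- Carathéodory's bound for `1 - u s`, with `u` rotating `s 0` onto `|s 0|`. It is weaker than
    -- the Schwarz–Pick bound `1 - |s 0|²` for `n = 1`, but linear in `1 - |s 0|`.
    have h := norm_taylorCoeff_le_of_re_nonneg (H := fun z => 1 + (-u) * s z) (n := n)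
      (by fun_prop) (fun z hz => ?_) hn
    · have ha : AnalyticAt ℂ s 0 := hs.analyticAt (isOpen_unitDisk.mem_nhds zero_mem_unitDisk)
      rw [taylorCoeff_add analyticAt_const (by fun_prop), taylorCoeff_const, if_neg hn,
        taylorCoeff_const_mul ha, zero_add, norm_mul, norm_neg, hu, one_mul] at h
      simpa [hua, sub_eq_add_neg] using h
    · have h1 : ‖u * s z‖ ≤ 1 := by rw [norm_mul, hu, one_mul]; exact hb z hz
      have h2 := Complex.re_le_norm (u * s z)
      simp only [neg_mul, Complex.add_re, Complex.one_re, Complex.neg_re]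
      linarith

/-! ### Univalent and starlike functions. -/

open Filter Topology in
/-- The inverse of an injective analytic function of one complex variable is analytic. -/
lemma analyticAt_invFunOn {g : ℂ → ℂ} {U : Set ℂ} (hU : IsOpen U) (hg : AnalyticOnNhd ℂ g U)
    (hinj : Set.InjOn g U) {z₀ : ℂ} (hz₀ : z₀ ∈ U) :
    AnalyticAt ℂ (Function.invFunOn g U) (g z₀) := by
  set h := Function.invFunOn g U
  have hleft : ∀ z ∈ U, h (g z) = z := fun z hz => hinj.leftInvOn_invFunOn hz
  have not_const : ∀ z ∈ U, ¬ ∀ᶠ x in 𝓝 z, g x = g z := by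
    intro z hz hc
    have h1 : ∀ᶠ x in 𝓝[≠] z, x = z := by
      filter_upwards [nhdsWithin_le_nhds hc, nhdsWithin_le_nhds (hU.mem_nhds hz)] with x hx hxU
      exact hinj hxU hz hx
    obtain ⟨x, hx, hx'⟩ := (h1.and self_mem_nhdsWithin).exists
    exact hx' hx
  have hopen : ∀ z ∈ U, 𝓝 (g z) ≤ map g (𝓝 z) := fun z hz =>
    (hg z hz).eventually_constant_or_nhds_le_map_nhds.resolve_left (not_const z hz)
  have hcont : ∀ z ∈ U, ContinuousAt h (g z) := by
    intro z hz
    have : map h (𝓝 (g z)) ≤ 𝓝 z := calc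
      map h (𝓝 (g z)) ≤ map h (map g (𝓝 z)) := map_mono (hopen z hz)
      _ = map id (𝓝 z) := by
        rw [map_map]
        refine Filter.map_congr ?_
        filter_upwards [hU.mem_nhds hz] with x hx using hleft x hx
      _ = 𝓝 z := map_id
    rw [ContinuousAt, hleft z hz]
    exact this
  -- Zeros of `g'` are isolated, so the inverse is differentiable near `g z₀` except perhaps at that
  -- point, where continuity removes the singularity. Thus `g' z₀ ≠ 0` is not needed in advance.
  refine Complex.analyticAt_of_differentiable_on_punctured_nhds_of_continuousAt ?_ (hcont z₀ hz₀)
  have hder : ∀ᶠ z in 𝓝[≠] z₀, deriv g z ≠ 0 := by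
    rcases (hg z₀ hz₀).deriv.eventually_eq_zero_or_eventually_ne_zero with h0 | h0
    · refine absurd ?_ (not_const z₀ hz₀)
      obtain ⟨r, hr, hball⟩ := Metric.eventually_nhds_iff_ball.mp (h0.and (hU.mem_nhds hz₀))
      filter_upwards [Metric.ball_mem_nhds z₀ hr] with x hx
      exact Metric.isOpen_ball.is_const_of_deriv_eq_zero
        (convex_ball z₀ r).isPreconnected
        (fun y hy => (hg y (hball y hy).2).differentiableAt.differentiableWithinAt)
        (fun y hy => (hball y hy).1) hx (Metric.mem_ball_self hr)
    · exact h0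
  rw [eventually_nhdsWithin_iff] at hder ⊢
  refine hopen z₀ hz₀ ?_
  rw [mem_map]
  filter_upwards [hder, hU.mem_nhds hz₀] with z hz hzU hne
  have hne' : z ≠ z₀ := fun h => hne (by rw [h]; rfl)
  have hz' : HasDerivAt g (deriv g z) (h (g z)) := by
    rw [hleft z hzU]; exact (hg z hzU).differentiableAt.hasDerivAt
  refine (hz'.of_local_left_inverse (hcont z hzU) (hz hne') ?_).differentiableAt
  refine hopen z hzU ?_
  rw [mem_map]
  filter_upwards [hU.mem_nhds hzU] with x hx
  simp only [Set.mem_preimage, Set.mem_ofPred_eq, hleft x hx]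

lemma IsStarlike.ne_zero {g : ℂ → ℂ} (hg : IsStarlike g) {z : ℂ} (hz : z ∈ unitDisk)
    (h0 : z ≠ 0) : g z ≠ 0 := fun h =>
  h0 (hg.univalent hz zero_mem_unitDisk (h.trans hg.normalized.map_zero.symm))

open Filter Topology in
/-- The analytic characterization of starlike functions. -/
theorem IsStarlike.re_nonneg {g : ℂ → ℂ} (hg : IsStarlike g) {z₀ : ℂ} (hz₀ : z₀ ∈ unitDisk)
    (h0 : z₀ ≠ 0) : 0 ≤ (z₀ * deriv g z₀ / g z₀).re := by
  have han := hg.normalized.analytic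
  set h := Function.invFunOn g unitDisk
  have hleft : ∀ z ∈ unitDisk, h (g z) = z := fun z hz => hg.univalent.leftInvOn_invFunOn hz
  have hana : ∀ z ∈ unitDisk, AnalyticAt ℂ h (g z) := fun z hz =>
    analyticAt_invFunOn isOpen_unitDisk han hg.univalent hz
  -- By starlikeness `z ↦ h(t g(z))` is a self-map of the disk fixing 0, so the Schwarz lemma
  -- applies.
  have hbound : ∀ t : ℝ, 0 ≤ t → t ≤ 1 → ‖h (t * g z₀)‖ ≤ ‖z₀‖ := by
    intro t ht0 ht1
    have key : ∀ z ∈ unitDisk, ∃ y ∈ unitDisk, g y = t * g z := fun z hz =>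
      hg.starlike _ ⟨z, hz, rfl⟩ t ht0 ht1
    refine Complex.norm_le_norm_of_mapsTo_ball (R := 1) (f := fun z => h (t * g z)) ?_ ?_ ?_
      (mem_unitDisk.mp hz₀)
    · intro z hz
      obtain ⟨y, hy, hyz⟩ := key z hz
      have h1 := hana y hy
      rw [hyz] at h1
      exact (h1.differentiableAt.comp z
        ((han z hz).differentiableAt.const_mul (t : ℂ))).differentiableWithinAt
    · intro z hz
      obtain ⟨y, hy, hyz⟩ := key z hz
      simp only [← hyz, hleft y hy]
      exact Metric.ball_subset_closedBall hy
    · have := hleft 0 zero_mem_unitDisk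
      simpa [hg.normalized.map_zero] using this
  have hdg : HasDerivAt g (deriv g z₀) z₀ := (han z₀ hz₀).differentiableAt.hasDerivAt
  have hdh : HasDerivAt h (deriv h (g z₀)) (g z₀) := (hana z₀ hz₀).differentiableAt.hasDerivAt
  have hprod : deriv h (g z₀) * deriv g z₀ = 1 := by
    refine (hdh.comp z₀ hdg).unique ((hasDerivAt_id z₀).congr_of_eventuallyEq ?_)
    filter_upwards [isOpen_unitDisk.mem_nhds hz₀] with x hx using hleft x hx
  have hc : HasDerivAt (fun t : ℝ => h (t * g z₀)) (deriv h (g z₀) * g z₀) 1 := by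
    have h1 : HasDerivAt (fun x : ℂ => x * g z₀) (g z₀) ((1 : ℝ) : ℂ) := by
      simpa using (hasDerivAt_id ((1 : ℝ) : ℂ)).mul_const (g z₀)
    have h2 : HasDerivAt h (deriv h (g z₀)) (((1 : ℝ) : ℂ) * g z₀) := by simpa using hdh
    exact (HasDerivAt.comp (h := fun x : ℂ => x * g z₀) ((1 : ℝ) : ℂ) h2 h1).comp_ofReal
  have hsq := hc.norm_sq
  -- `|h(t g(z₀))|²` on `0 < t < 1` does not exceed its value at `t = 1`, so its derivative at 1 is
  -- nonnegative. That derivative is `2|z₀|² Re (1/A)` with `A = z₀ g'(z₀)/g(z₀)`.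
  have hnn := ge_of_tendsto (b := (0 : ℝ)) ((hasDerivAt_iff_tendsto_slope.mp hsq).mono_left
    (nhdsWithin_mono 1 (fun x (hx : x ∈ Set.Iio (1 : ℝ)) => ne_of_lt hx))) (by
      filter_upwards [Ioo_mem_nhdsLT (zero_lt_one' ℝ)] with t ht
      have hb := hbound t ht.1.le ht.2.le
      rw [slope_def_field]
      refine div_nonneg_of_nonpos ?_ (by linarith [ht.2])
      simp only [Complex.ofReal_one, one_mul, hleft z₀ hz₀]
      have := pow_le_pow_left₀ (norm_nonneg _) hb 2
      linarith)
  have hgd : deriv g z₀ ≠ 0 := right_ne_zero_of_mul_eq_one hprod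
  have hgz := hg.ne_zero hz₀ h0
  have hder : deriv h (g z₀) = (deriv g z₀)⁻¹ := eq_inv_of_mul_eq_one_left hprod
  simp only [Complex.ofReal_one, one_mul, hleft z₀ hz₀, hder, Complex.inner] at hnn
  set A := z₀ * deriv g z₀ / g z₀ with hA
  have hrew : (starRingEnd ℂ) z₀ * ((deriv g z₀)⁻¹ * g z₀) =
      ((Complex.normSq z₀ : ℝ) : ℂ) * A⁻¹ := by
    rw [← Complex.mul_conj, hA]
    field_simp
  have hns := Complex.normSq_pos.mpr h0
  rw [mul_comm ((deriv g z₀)⁻¹ * g z₀), hrew, Complex.re_ofReal_mul] at hnn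
  have hAi : 0 ≤ (A⁻¹).re := by
    by_contra hneg
    push Not at hneg
    nlinarith
  rw [Complex.inv_re] at hAi
  have hAn : 0 < Complex.normSq A := Complex.normSq_pos.mpr (by
    rw [hA]; exact div_ne_zero (mul_ne_zero h0 hgd) hgz)
  by_contra hneg
  exact absurd (div_neg_of_neg_of_pos (not_le.mp hneg) hAn) (not_lt.mpr hAi)

/-! ### Passage to self-maps of the disk. -/

/-- The first coefficients of a function whose values lie in a rotated half-plane, in terms of the
coefficients of the associated self-map of the disk. -/
theorem exists_schur_coeffs {p : ℂ → ℂ} {α : ℝ} (hp : DifferentiableOn ℂ p unitDisk)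
    (h0 : p 0 = 1) (hα : 0 < Real.cos α)
    (hre : ∀ z ∈ unitDisk, 0 ≤ (Complex.exp (Complex.I * α) * p z).re) :
    ∃ s₀ s₁ s₂ : ℂ, ‖s₀‖ ≤ 1 ∧ (‖s₁‖ ≤ 1 ∧ ‖s₁‖ ≤ 2 * (1 - ‖s₀‖)) ∧
      (‖s₂‖ ≤ 1 ∧ ‖s₂‖ ≤ 2 * (1 - ‖s₀‖)) ∧
      taylorCoeff p 1 = 2 * (Real.cos α * Complex.exp (-(Complex.I * α))) * s₀ ∧
      taylorCoeff p 2 = 2 * (Real.cos α * Complex.exp (-(Complex.I * α))) * (s₁ + s₀ ^ 2) ∧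
      taylorCoeff p 3 = 2 * (Real.cos α * Complex.exp (-(Complex.I * α))) *
        (s₂ + 2 * s₀ * s₁ + s₀ ^ 3) := by
  set e := Complex.exp (Complex.I * α) with he
  set e' := Complex.exp (-(Complex.I * α)) with he'
  have hee : e * e' = 1 := by rw [he, he', ← Complex.exp_add]; simp
  have hconj : e' = (starRingEnd ℂ) e := by
    rw [he, he', ← Complex.exp_conj]; simp
  have hen : ‖e‖ = 1 := by rw [he, mul_comm]; exact Complex.norm_exp_ofReal_mul_I α
  have hecos : e.re = Real.cos α := by
    rw [he, mul_comm]; exact Complex.exp_ofReal_mul_I_re α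
  set m := e' ^ 2 with hm
  have hm1 : 1 + m = 2 * (Real.cos α * e') := by
    have h1 : e + e' = 2 * (Real.cos α : ℂ) := by
      rw [hconj, Complex.add_conj, hecos]; push_cast; rfl
    linear_combination (-1 : ℂ) * hee + e' * h1
  have hden : ∀ z ∈ unitDisk, p z + m ≠ 0 := by
    intro z hz h
    have h1 : e * p z + e' = 0 := by linear_combination e * h - e' * hee
    have h2 := congrArg Complex.re h1
    rw [Complex.add_re, hconj, Complex.conj_re, hecos, Complex.zero_re] at h2
    linarith [hre z hz]
  -- Multiplied by `e`, numerator and denominator become `ep - e` and `ep + conj e`. Since `ep` lies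
  -- in the closed right half-plane, it is no farther from `e` than from the mirror image `-conj e`;
  -- hence `|w| ≤ 1`.
  set w : ℂ → ℂ := fun z => (p z - 1) / (p z + m) with hw
  have hwd : DifferentiableOn ℂ w unitDisk :=
    (hp.sub_const 1).div (hp.add_const m) hden
  have hw0 : w 0 = 0 := by simp [hw, h0]
  have hwb : ∀ z ∈ unitDisk, ‖w z‖ ≤ 1 := by
    intro z hz
    rw [hw, norm_div, div_le_one (norm_pos_iff.mpr (hden z hz))]
    have h1 : ‖p z - 1‖ = ‖e * p z - e‖ := by
      rw [← mul_sub_one, norm_mul, hen, one_mul]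
    have h2 : ‖p z + m‖ = ‖e * p z + (starRingEnd ℂ) e‖ := by
      have : e * p z + (starRingEnd ℂ) e = e * (p z + m) := by
        rw [← hconj]; linear_combination (-e') * hee
      rw [this, norm_mul, hen, one_mul]
    rw [h1, h2, ← sq_le_sq₀ (norm_nonneg _) (norm_nonneg _), ← Complex.normSq_eq_norm_sq,
      ← Complex.normSq_eq_norm_sq, Complex.normSq_apply, Complex.normSq_apply]
    have h3 := mul_nonneg (hre z hz) (hecos ▸ hα.le : 0 ≤ e.re)
    simp only [Complex.sub_re, Complex.add_re, Complex.sub_im, Complex.add_im, Complex.conj_re,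
      Complex.conj_im]
    nlinarith
  set s := dslope w 0 with hs
  have hsd : DifferentiableOn ℂ s unitDisk :=
    (Complex.differentiableOn_dslope (isOpen_unitDisk.mem_nhds zero_mem_unitDisk)).mpr hwd
  have hsb : ∀ z ∈ unitDisk, ‖s z‖ ≤ 1 := by
    intro z hz
    have := Complex.norm_dslope_le_div_of_mapsTo_ball (R₁ := 1) (R₂ := 1) hwd
      (fun x hx => by rw [hw0]; simpa using hwb x hx) hz
    simpa using this
  have hpa : AnalyticAt ℂ p 0 := hp.analyticAt (isOpen_unitDisk.mem_nhds zero_mem_unitDisk)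
  have hsa : AnalyticAt ℂ s 0 := hsd.analyticAt (isOpen_unitDisk.mem_nhds zero_mem_unitDisk)
  have hqa : AnalyticAt ℂ (fun z => p z + m) 0 := hpa.add analyticAt_const
  -- The relation `p - 1 = z s (p + m)` gives a recursion for the coefficients of `p`, in which `p +
  -- m` has constant term `1 + m = 2 cos α · e^{-iα}`.
  have hpeq : p =ᶠ[nhds 0] fun z => 1 + z * (s z * (p z + m)) := by
    filter_upwards [isOpen_unitDisk.mem_nhds zero_mem_unitDisk] with z hz
    have h1 : z * s z = w z := by
      have := sub_smul_dslope w 0 z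
      simpa [hw0] using this
    rw [← mul_assoc, h1, hw, div_mul_cancel₀ _ (hden z hz)]
    ring
  have hrec : ∀ n, taylorCoeff p (n + 1) =
      ∑ i ∈ Finset.range (n + 1), taylorCoeff s i * taylorCoeff (fun z => p z + m) (n - i) := by
    intro n
    rw [taylorCoeff_congr hpeq, taylorCoeff_add analyticAt_const (by fun_prop),
      taylorCoeff_const, if_neg n.succ_ne_zero, zero_add,
      taylorCoeff_id_mul (f := fun z => s z * (p z + m)) (hsa.mul hqa), taylorCoeff_mul hsa hqa]
  have hq : ∀ n, taylorCoeff (fun z => p z + m) n = taylorCoeff p n + if n = 0 then m else 0 :=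
    fun n => by rw [taylorCoeff_add hpa analyticAt_const, taylorCoeff_const]
  have hp0 : taylorCoeff p 0 = 1 := by rw [taylorCoeff_zero, h0]
  have r1 := hrec 0
  have r2 := hrec 1
  have r3 := hrec 2
  simp only [Finset.sum_range_succ, Finset.sum_range_zero, hq, hp0, zero_add, hm1,
    Nat.reduceAdd, Nat.reduceSub, if_true, one_ne_zero, OfNat.ofNat_ne_zero, if_false, add_zero,
    Nat.sub_zero, Nat.sub_self] at r1 r2 r3
  have hs0 : taylorCoeff s 0 = s 0 := taylorCoeff_zero s
  refine ⟨taylorCoeff s 0, taylorCoeff s 1, taylorCoeff s 2, ?_, ?_, ?_, ?_, ?_, ?_⟩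
  · rw [hs0]; exact hsb 0 zero_mem_unitDisk
  · rw [hs0]; exact norm_taylorCoeff_le_of_norm_le_one hsd hsb one_ne_zero
  · rw [hs0]; exact norm_taylorCoeff_le_of_norm_le_one hsd hsb two_ne_zero
  · rw [r1]; ring
  · rw [r2, r1]; ring
  · rw [r3, r2, r1]; ring

lemma norm_taylorCoeff_le_two {p : ℂ → ℂ} {α : ℝ} (hp : DifferentiableOn ℂ p unitDisk)
    (h0 : p 0 = 1) (hre : ∀ z ∈ unitDisk, 0 ≤ (Complex.exp (Complex.I * α) * p z).re)
    {n : ℕ} (hn : n ≠ 0) : ‖taylorCoeff p n‖ ≤ 2 := by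
  have hpa : AnalyticAt ℂ p 0 := hp.analyticAt (isOpen_unitDisk.mem_nhds zero_mem_unitDisk)
  have h := norm_taylorCoeff_le_of_re_nonneg (hp.const_mul (Complex.exp (Complex.I * α))) hre hn
  have he : ‖Complex.exp (Complex.I * α)‖ = 1 := by
    rw [mul_comm]; exact Complex.norm_exp_ofReal_mul_I α
  rw [taylorCoeff_const_mul hpa, norm_mul, he, one_mul, h0, mul_one] at h
  have := Complex.re_le_norm (Complex.exp (Complex.I * α))
  linarith

/-! ### The quadratic factor. -/

/-- Elementary majorant used to bound the quadratic factor of the determinant. -/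
lemma majorant_le {x y r t : ℝ} (hx : 0 ≤ x) (hx' : x ≤ 1 / 2) (hy : 0 ≤ y) (hy' : y ≤ 1 / 2)
    (hr : 0 ≤ r) (hrx : r ≤ 1 - x) (ht : 0 ≤ t) (hty : t ≤ 1 - y) :
    (r + t) ^ 2 + r ^ 4 + 17 / 6 * (r ^ 3 * t) + 67 / 18 * (r ^ 2 * t ^ 2) +
      37 / 18 * (r * t ^ 3) + 7 / 18 * t ^ 4 + 2 * x * (13 / 9) + 2 * y * 4 + 1 / 3 * (2 * x) +
      2 * y + 2 / 9 * (2 * x + 4 * y) ^ 2 ≤ 14 := by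
  have hr1 : r ≤ 1 := by linarith
  have ht1 : t ≤ 1 := by linarith
  -- `(1 - x)² ≤ 1 - 3x/2` exactly because `0 ≤ x ≤ 1/2`. Such linear bounds leave negative net
  -- coefficients of `x` and `y`, and the constant term is 14, attained at `x = y = 0`, `r = t = 1`.
  have hr2 : r ^ 2 ≤ 1 - 3 / 2 * x := by nlinarith
  have ht2 : t ^ 2 ≤ 1 - 3 / 2 * y := by nlinarith
  have hr4 : r ^ 4 ≤ r ^ 2 := pow_le_pow_of_le_one hr hr1 (by norm_num)
  have ht4 : t ^ 4 ≤ t ^ 2 := pow_le_pow_of_le_one ht ht1 (by norm_num)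
  have hr3t : r ^ 3 * t ≤ r * t :=
    mul_le_mul_of_nonneg_right (pow_le_of_le_one hr hr1 three_ne_zero) ht
  have hrt : r * t ≤ (r + t) / 2 := by
    linarith [mul_le_of_le_one_left ht hr1, mul_le_of_le_one_right hr ht1]
  have hrt2 : r ^ 2 * t ^ 2 ≤ t ^ 2 :=
    mul_le_of_le_one_left (sq_nonneg t) (pow_le_one₀ hr hr1)
  have hrt3 : r * t ^ 3 ≤ t ^ 2 := by
    have h3 : t ^ 3 ≤ t ^ 2 := pow_le_pow_of_le_one ht ht1 (by norm_num)
    exact (mul_le_of_le_one_left (pow_nonneg ht 3) hr1).trans h3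
  have hxy : (x + 2 * y) ^ 2 ≤ 3 / 2 * (x + 2 * y) := by nlinarith
  have hsq : (r + t) ^ 2 ≤ 2 * r ^ 2 + 2 * t ^ 2 := by nlinarith [sq_nonneg (r - t)]
  nlinarith

section circle

variable {l : ℂ}

lemma norm_le_one_of_norm_sq_eq_re (hl : ‖l‖ ^ 2 = l.re) : ‖l‖ ≤ 1 := by
  have := Complex.re_le_norm l
  nlinarith [norm_nonneg l]

/-- On the circle the cross term `Re l` is itself `|l|²`, so `|a - bl|²` is affine in `|l|² ∈ [0,
1]` and is largest at an endpoint. -/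
lemma norm_sub_mul_sq (a b : ℝ) (hl : ‖l‖ ^ 2 = l.re) :
    ‖(a : ℂ) - b * l‖ ^ 2 = a ^ 2 + (b ^ 2 - 2 * a * b) * ‖l‖ ^ 2 := by
  have h : ‖l‖ ^ 2 = l.re ^ 2 + l.im ^ 2 := by
    rw [← Complex.normSq_eq_norm_sq, Complex.normSq_apply]; ring
  have h' : ‖(a : ℂ) - b * l‖ ^ 2 = (a - b * l.re) ^ 2 + (b * l.im) ^ 2 := by
    rw [← Complex.normSq_eq_norm_sq, Complex.normSq_apply]; simp; ring
  rw [h', sub_mul, mul_assoc (2 * a), hl]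
  linear_combination b ^ 2 * (hl - h)

lemma norm_half_sub_le (hl : ‖l‖ ^ 2 = l.re) : ‖1 / 2 - 23 / 9 * l‖ ≤ 37 / 18 := by
  have h := norm_sub_mul_sq (1 / 2) (23 / 9) hl
  push_cast at h
  have h1 := norm_le_one_of_norm_sq_eq_re hl
  have h2 : ‖l‖ ^ 2 ≤ 1 := pow_le_one₀ (norm_nonneg _) h1
  refine le_of_sq_le_sq ?_ (by norm_num)
  rw [h]; linarith

lemma norm_one_sub_le (hl : ‖l‖ ^ 2 = l.re) : ‖1 - 23 / 9 * l‖ ≤ 14 / 9 := by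
  have h := norm_sub_mul_sq 1 (23 / 9) hl
  push_cast at h
  have h1 := norm_le_one_of_norm_sq_eq_re hl
  have h2 : ‖l‖ ^ 2 ≤ 1 := pow_le_one₀ (norm_nonneg _) h1
  refine le_of_sq_le_sq ?_ (by norm_num)
  rw [h]; linarith

lemma norm_mul_sub_le (hl : ‖l‖ ^ 2 = l.re) : ‖l‖ * ‖8 / 9 - 1 / 2 * l‖ ≤ 1 / 2 := by
  have h := norm_sub_mul_sq (8 / 9) (1 / 2) hl
  push_cast at h
  refine le_of_sq_le_sq ?_ (by norm_num)
  rw [mul_pow, h]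
  -- The squared product is a concave quadratic in `|l|²` with maximum at `128/207`, close to `3/5`.
  nlinarith [sq_nonneg (‖l‖ ^ 2 - 3 / 5)]

/-- The quadratic factor of the determinant has modulus at most `14`. -/
theorem norm_quadratic_factor_le {l s s₁ s₂ t t₁ t₂ a₂ a₃ a₄ : ℂ} (hl : ‖l‖ ^ 2 = l.re)
    (hs : ‖s‖ ≤ 1) (hs₁ : ‖s₁‖ ≤ 1 ∧ ‖s₁‖ ≤ 2 * (1 - ‖s‖))
    (hs₂ : ‖s₂‖ ≤ 1 ∧ ‖s₂‖ ≤ 2 * (1 - ‖s‖)) (ht : ‖t‖ ≤ 1)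
    (ht₁ : ‖t₁‖ ≤ 1 ∧ ‖t₁‖ ≤ 2 * (1 - ‖t‖)) (ht₂ : ‖t₂‖ ≤ 1 ∧ ‖t₂‖ ≤ 2 * (1 - ‖t‖))
    (h₂ : a₂ = s + l * t)
    (h₃ : 3 * a₃ = s₁ + 3 * s ^ 2 + 4 * l * s * t + 2 * l * (t₁ + t ^ 2))
    (h₄ : 4 * a₄ = 2 / 3 * s₂ + 10 / 3 * s * s₁ + 4 * s ^ 3 + 2 * l * t * (s₁ + 3 * s ^ 2) +
      4 * l * s * (t₁ + t ^ 2) + 2 * l * (t₂ + 2 * t * t₁ + t ^ 3)) :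
    ‖a₂ ^ 2 - 2 * a₃ ^ 2 + a₂ * a₄‖ ≤ 14 := by
  have hl1 := norm_le_one_of_norm_sq_eq_re hl
  have e₃ : a₃ = (s₁ + 3 * s ^ 2 + 4 * l * s * t + 2 * l * (t₁ + t ^ 2)) / 3 := by
    rw [← h₃]; ring
  have e₄ : a₄ = (2 / 3 * s₂ + 10 / 3 * s * s₁ + 4 * s ^ 3 + 2 * l * t * (s₁ + 3 * s ^ 2) +
      4 * l * s * (t₁ + t ^ 2) + 2 * l * (t₂ + 2 * t * t₁ + t ^ 3)) / 4 := by
    rw [← h₄]; ring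
  set k₁ : ℂ := -(1 / 2 * s ^ 2) + -(4 / 9 * (l * s * t)) + -(l * (8 / 9 - 1 / 2 * l) * t ^ 2)
    with hk₁
  set k₂ : ℂ := -(5 / 3 * s ^ 2) + (1 - 23 / 9 * l) * (s * t) + -(7 / 9 * (l * t ^ 2)) with hk₂
  -- Grouped by dependence on `s₁, t₁, s₂, t₂`; the only part quadratic in these comes from `-2a₃²`.
  -- Factors such as `1/2 - 23/9 l` stay whole, since splitting them would lose the sharp constant
  -- 14.
  have hdecomp : a₂ ^ 2 - 2 * a₃ ^ 2 + a₂ * a₄ =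
      (s + l * t) ^ 2 + -s ^ 4 + -(17 / 6 * (l * (s ^ 3 * t))) +
      -((5 / 3 * l + 37 / 18 * l ^ 2) * (s ^ 2 * t ^ 2)) +
      l * (1 / 2 - 23 / 9 * l) * (s * t ^ 3) + -(7 / 18 * (l ^ 2 * t ^ 4)) +
      s₁ * k₁ + t₁ * (l * k₂) + 1 / 6 * ((s + l * t) * s₂) + 1 / 2 * (l * (s + l * t) * t₂) +
      -(2 / 9 * (s₁ + 2 * l * t₁) ^ 2) := by
    rw [e₃, e₄, h₂, hk₁, hk₂]; ring
  set r := ‖s‖ with hr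
  set q := ‖t‖ with hq
  have hr0 : 0 ≤ r := norm_nonneg _
  have hq0 : 0 ≤ q := norm_nonneg _
  have hl0 : 0 ≤ ‖l‖ := norm_nonneg _
  have drop (u : ℝ) (hu : 0 ≤ u) : ‖l‖ * u ≤ u := mul_le_of_le_one_left hu hl1
  have hlt : ‖s + l * t‖ ≤ r + q := by
    refine (norm_add_le _ _).trans ?_
    rw [norm_mul]; linarith [drop q hq0]
  have hlt2 : ‖s + l * t‖ ≤ 2 := by linarith
  have b1 : ‖(s + l * t) ^ 2‖ ≤ (r + q) ^ 2 := by
    rw [norm_pow]; exact pow_le_pow_left₀ (norm_nonneg _) hlt 2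
  have b2 : ‖-s ^ 4‖ = r ^ 4 := by rw [norm_neg, norm_pow]
  have b3 : ‖-(17 / 6 * (l * (s ^ 3 * t)))‖ ≤ 17 / 6 * (r ^ 3 * q) := by
    simp only [norm_neg, norm_mul, norm_div, norm_pow, Complex.norm_ofNat]
    exact mul_le_mul_of_nonneg_left (drop _ (by positivity)) (by norm_num)
  have b4 : ‖-((5 / 3 * l + 37 / 18 * l ^ 2) * (s ^ 2 * t ^ 2))‖ ≤
      67 / 18 * (r ^ 2 * q ^ 2) := by
    have : ‖5 / 3 * l + 37 / 18 * l ^ 2‖ ≤ 67 / 18 := by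
      refine (norm_add_le _ _).trans ?_
      simp only [norm_mul, norm_div, norm_pow, Complex.norm_ofNat]
      have := pow_le_one₀ hl0 hl1 (n := 2)
      linarith
    rw [norm_neg, norm_mul, norm_mul, norm_pow, norm_pow]
    exact mul_le_mul_of_nonneg_right this (by positivity)
  have b5 : ‖l * (1 / 2 - 23 / 9 * l) * (s * t ^ 3)‖ ≤ 37 / 18 * (r * q ^ 3) := by
    rw [norm_mul, norm_mul, norm_mul, norm_pow]
    refine mul_le_mul_of_nonneg_right ?_ (by positivity)
    exact (drop _ (norm_nonneg _)).trans (norm_half_sub_le hl)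
  have b6 : ‖-(7 / 18 * (l ^ 2 * t ^ 4))‖ ≤ 7 / 18 * q ^ 4 := by
    simp only [norm_neg, norm_mul, norm_div, norm_pow, Complex.norm_ofNat]
    refine mul_le_mul_of_nonneg_left ?_ (by norm_num)
    exact mul_le_of_le_one_left (by positivity) (pow_le_one₀ hl0 hl1)
  have hr2 : r ^ 2 ≤ 1 := pow_le_one₀ hr0 hs
  have hq2 : q ^ 2 ≤ 1 := pow_le_one₀ hq0 ht
  have hrq : r * q ≤ 1 := mul_le_one₀ hs hq0 ht
  have hk₁b : ‖k₁‖ ≤ 13 / 9 := by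
    have c1 : ‖-(1 / 2 * s ^ 2)‖ ≤ 1 / 2 := by
      simp only [norm_neg, norm_mul, norm_div, norm_pow, Complex.norm_ofNat, norm_one]
      linarith
    have c2 : ‖-(4 / 9 * (l * s * t))‖ ≤ 4 / 9 := by
      simp only [norm_neg, norm_mul, norm_div, Complex.norm_ofNat, mul_assoc]
      have := drop (r * q) (by positivity)
      linarith
    have c3 : ‖-(l * (8 / 9 - 1 / 2 * l) * t ^ 2)‖ ≤ 1 / 2 := by
      rw [norm_neg, norm_mul, norm_mul, norm_pow]
      exact (mul_le_of_le_one_right (by positivity) hq2).trans (norm_mul_sub_le hl)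
    refine (norm_add₃_le).trans ?_
    linarith
  have hk₂b : ‖l * k₂‖ ≤ 4 := by
    have c1 : ‖-(5 / 3 * s ^ 2)‖ ≤ 5 / 3 := by
      simp only [norm_neg, norm_mul, norm_div, norm_pow, Complex.norm_ofNat]
      linarith
    have c2 : ‖(1 - 23 / 9 * l) * (s * t)‖ ≤ 14 / 9 := by
      rw [norm_mul, norm_mul]
      exact (mul_le_of_le_one_right (norm_nonneg _) hrq).trans (norm_one_sub_le hl)
    have c3 : ‖-(7 / 9 * (l * t ^ 2))‖ ≤ 7 / 9 := by
      simp only [norm_neg, norm_mul, norm_div, norm_pow, Complex.norm_ofNat]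
      have := drop (q ^ 2) (by positivity)
      linarith
    rw [norm_mul]
    refine (drop _ (norm_nonneg _)).trans ((norm_add₃_le).trans ?_)
    linarith
  -- `2x` and `2y` merge the two available bounds on the higher coefficients.
  set x := min (1 / 2) (1 - r) with hx
  set y := min (1 / 2) (1 - q) with hy
  have hx1 : x ≤ 1 / 2 := min_le_left _ _
  have hy1 : y ≤ 1 / 2 := min_le_left _ _
  have hxr : x ≤ 1 - r := min_le_right _ _
  have hyq : y ≤ 1 - q := min_le_right _ _
  have hx0 : 0 ≤ x := le_min (by norm_num) (by linarith)
  have hy0 : 0 ≤ y := le_min (by norm_num) (by linarith)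
  have toMin {a b : ℝ} (h : a ≤ 1 ∧ a ≤ 2 * (1 - b)) : a ≤ 2 * min (1 / 2) (1 - b) := by
    have : a / 2 ≤ min (1 / 2) (1 - b) := le_min (by linarith [h.1]) (by linarith [h.2])
    linarith
  have d1 : ‖s₁‖ ≤ 2 * x := toMin hs₁
  have d2 : ‖s₂‖ ≤ 2 * x := toMin hs₂
  have d3 : ‖t₁‖ ≤ 2 * y := toMin ht₁
  have d4 : ‖t₂‖ ≤ 2 * y := toMin ht₂
  have b7 : ‖s₁ * k₁‖ ≤ 2 * x * (13 / 9) := by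
    rw [norm_mul]; exact mul_le_mul d1 hk₁b (norm_nonneg _) (by positivity)
  have b8 : ‖t₁ * (l * k₂)‖ ≤ 2 * y * 4 := by
    rw [norm_mul]; exact mul_le_mul d3 hk₂b (norm_nonneg _) (by positivity)
  have b9 : ‖1 / 6 * ((s + l * t) * s₂)‖ ≤ 1 / 3 * (2 * x) := by
    rw [norm_mul, norm_mul, norm_div, norm_one, Complex.norm_ofNat]
    have := mul_le_mul hlt2 d2 (norm_nonneg _) (by norm_num)
    linarith
  have b10 : ‖1 / 2 * (l * (s + l * t) * t₂)‖ ≤ 2 * y := by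
    rw [norm_mul, norm_mul, norm_mul, norm_div, norm_one, Complex.norm_ofNat]
    have h1 : ‖l‖ * ‖s + l * t‖ ≤ 2 := (drop _ (norm_nonneg _)).trans hlt2
    have := mul_le_mul h1 d4 (norm_nonneg _) (by norm_num)
    linarith
  have b11 : ‖-(2 / 9 * (s₁ + 2 * l * t₁) ^ 2)‖ ≤ 2 / 9 * (2 * x + 4 * y) ^ 2 := by
    have h1 : ‖s₁ + 2 * l * t₁‖ ≤ 2 * x + 4 * y := by
      refine (norm_add_le _ _).trans ?_
      rw [norm_mul, norm_mul, Complex.norm_ofNat, mul_assoc]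
      have := drop ‖t₁‖ (norm_nonneg _)
      linarith
    rw [norm_neg, norm_mul, norm_pow, norm_div, Complex.norm_ofNat, Complex.norm_ofNat]
    exact mul_le_mul_of_nonneg_left (pow_le_pow_left₀ (norm_nonneg _) h1 2) (by norm_num)
  have hmaj := majorant_le hx0 hx1 hy0 hy1 hr0 (by linarith) hq0 (by linarith : q ≤ 1 - y)
  rw [hdecomp]
  refine (norm_add_le_of_le (norm_add_le_of_le (norm_add_le_of_le (norm_add_le_of_le
    (norm_add_le_of_le (norm_add_le_of_le (norm_add_le_of_le (norm_add_le_of_le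
    (norm_add_le_of_le (norm_add_le_of_le b1 b2.le) b3) b4) b5) b6) b7) b8) b9) b10) b11).trans ?_
  exact hmaj

end circle

/-! ### Coefficient relations and the determinant bound. -/

/-- The recursion between the coefficients of `F` and those of `z F'(z) / g(z)`, where
`g(z) = z G(z)`. -/
lemma taylorCoeff_deriv_eq_sum {F G : ℂ → ℂ} (hF : AnalyticOnNhd ℂ F unitDisk)
    (hG : DifferentiableOn ℂ G unitDisk) (hG0 : ∀ z ∈ unitDisk, G z ≠ 0) (n : ℕ) :
    (n + 1) * taylorCoeff F (n + 1) = ∑ i ∈ Finset.range (n + 1),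
      taylorCoeff (fun z => deriv F z / G z) i * taylorCoeff G (n - i) := by
  have hmem := isOpen_unitDisk.mem_nhds zero_mem_unitDisk
  have hGa : AnalyticAt ℂ G 0 := hG.analyticAt hmem
  have hFa : AnalyticAt ℂ (deriv F) 0 := (hF 0 zero_mem_unitDisk).deriv
  rw [← taylorCoeff_deriv, ← taylorCoeff_mul (f := fun z => deriv F z / G z)
    (hFa.div hGa (hG0 0 zero_mem_unitDisk)) hGa]
  refine taylorCoeff_congr ?_ n
  filter_upwards [hmem] with z hz
  exact (div_mul_cancel₀ _ (hG0 z hz)).symm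

theorem theorem2p6 (f : ℂ → ℂ) (hf : IsCloseToConvex f) :
    ‖toeplitzDet f 3 2‖ ≤ 86 := by
  obtain ⟨hfn, g, hg, α, hα, hre⟩ := hf
  have hcos : 0 < Real.cos α := Real.cos_pos_of_mem_Ioo hα
  have hmem := isOpen_unitDisk.mem_nhds zero_mem_unitDisk
  set G := dslope g 0 with hGdef
  have hgd : DifferentiableOn ℂ g unitDisk := hg.normalized.analytic.differentiableOn
  have hG : DifferentiableOn ℂ G unitDisk := (Complex.differentiableOn_dslope hmem).mpr hgd
  have hgG : ∀ z, g z = z * G z := fun z => by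
    have := sub_smul_dslope g 0 z
    simpa [hg.normalized.map_zero] using this.symm
  have hGz : G 0 = 1 := by rw [hGdef, dslope_same, hg.normalized.deriv_zero]
  have hG0 : ∀ z ∈ unitDisk, G z ≠ 0 := by
    intro z hz h
    rcases eq_or_ne z 0 with rfl | h0
    · rw [hGz] at h; exact one_ne_zero h
    · exact hg.ne_zero hz h0 (by rw [hgG, h, mul_zero])
  have hquot (F : ℂ → ℂ) {z : ℂ} (h0 : z ≠ 0) : z * deriv F z / g z = deriv F z / G z := by
    rw [hgG, mul_div_mul_left _ _ h0]
  have hdiff {F : ℂ → ℂ} (hF : AnalyticOnNhd ℂ F unitDisk) :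
      DifferentiableOn ℂ (fun z => deriv F z / G z) unitDisk :=
    hF.deriv.differentiableOn.div hG hG0
  set q : ℂ → ℂ := fun z => deriv g z / G z with hq
  set p : ℂ → ℂ := fun z => deriv f z / G z with hp
  have hq0 : q 0 = 1 := by simp [hq, hGz, hg.normalized.deriv_zero]
  have hp0 : p 0 = 1 := by simp [hp, hGz, hfn.deriv_zero]
  -- Written with angle 0, so that the lemmas for `p` also serve `q`; there `l = 1`.
  have hqre : ∀ z ∈ unitDisk, 0 ≤ (Complex.exp (Complex.I * (0 : ℝ)) * q z).re := by
    intro z hz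
    rcases eq_or_ne z 0 with rfl | h0
    · simp [hq0]
    · have := hg.re_nonneg hz h0
      rw [hquot g h0] at this
      simpa using this
  have hpre : ∀ z ∈ unitDisk, 0 ≤ (Complex.exp (Complex.I * α) * p z).re := by
    intro z hz
    rcases eq_or_ne z 0 with rfl | h0
    · rw [hp0, mul_one, mul_comm, Complex.exp_ofReal_mul_I_re]; exact hcos.le
    · have := hre z hz h0
      rw [hquot f h0] at this
      exact this.le
  have hqd := hdiff hg.normalized.analytic
  have hpd := hdiff hfn.analytic
  obtain ⟨s, s₁, s₂, hs, hs₁, hs₂, q1, q2, q3⟩ :=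
    exists_schur_coeffs hqd hq0 (by simp) hqre
  obtain ⟨t, t₁, t₂, ht, ht₁, ht₂, p1, p2, p3⟩ := exists_schur_coeffs hpd hp0 hcos hpre
  have nq1 := norm_taylorCoeff_le_two hqd hq0 hqre (n := 1) (by norm_num)
  have nq2 := norm_taylorCoeff_le_two hqd hq0 hqre (n := 2) (by norm_num)
  have nq3 := norm_taylorCoeff_le_two hqd hq0 hqre (n := 3) (by norm_num)
  have np1 := norm_taylorCoeff_le_two hpd hp0 hpre (n := 1) (by norm_num)
  have np2 := norm_taylorCoeff_le_two hpd hp0 hpre (n := 2) (by norm_num)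
  have np3 := norm_taylorCoeff_le_two hpd hp0 hpre (n := 3) (by norm_num)
  have hgc : ∀ n, taylorCoeff g (n + 1) = taylorCoeff G n := fun n => by
    rw [show g = fun z => z * G z from funext hgG, taylorCoeff_id_mul (hG.analyticAt hmem)]
  have hGc0 : taylorCoeff G 0 = 1 := by rw [taylorCoeff_zero, hGz]
  have hqc0 : taylorCoeff q 0 = 1 := by rw [taylorCoeff_zero, hq0]
  have hpc0 : taylorCoeff p 0 = 1 := by rw [taylorCoeff_zero, hp0]
  have rg := taylorCoeff_deriv_eq_sum hg.normalized.analytic hG hG0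
  have rf := taylorCoeff_deriv_eq_sum hfn.analytic hG hG0
  have g1 := rg 1
  have g2 := rg 2
  have g3 := rg 3
  have f1 := rf 1
  have f2 := rf 2
  have f3 := rf 3
  simp only [hgc] at g1 g2 g3
  simp only [← hq, ← hp, Finset.sum_range_succ, Finset.sum_range_zero, hGc0, hqc0, hpc0, zero_add,
    one_mul, mul_one, Nat.reduceAdd, Nat.reduceSub, Nat.sub_zero, Nat.sub_self, Nat.cast_one,
    Nat.cast_ofNat] at g1 g2 g3 f1 f2 f3
  set A₂ := taylorCoeff f 2
  set A₃ := taylorCoeff f 3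
  set A₄ := taylorCoeff f 4
  have hG1 : taylorCoeff G 1 = taylorCoeff q 1 := by linear_combination g1
  have hG2 : taylorCoeff G 2 = (taylorCoeff q 2 + taylorCoeff q 1 ^ 2) / 2 := by
    linear_combination g2 / 2 + taylorCoeff q 1 / 2 * hG1
  have hG3 : taylorCoeff G 3 = taylorCoeff q 3 / 3 + taylorCoeff q 1 * taylorCoeff q 2 / 2 +
      taylorCoeff q 1 ^ 3 / 6 := by
    linear_combination g3 / 3 + taylorCoeff q 1 / 3 * hG2 + taylorCoeff q 2 / 3 * hG1
  have nG1 : ‖taylorCoeff G 1‖ ≤ 2 := hG1 ▸ nq1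
  have hmul {a b : ℂ} {x y : ℝ} (ha : ‖a‖ ≤ x) (hb : ‖b‖ ≤ y) : ‖a * b‖ ≤ x * y :=
    norm_mul_le_of_le ha hb
  have nG2 : ‖taylorCoeff G 2‖ ≤ 3 := by
    rw [hG2, norm_div, Complex.norm_ofNat]
    have := norm_add_le_of_le nq2 (pow_two (taylorCoeff q 1) ▸ hmul nq1 nq1)
    linarith
  have nG3 : ‖taylorCoeff G 3‖ ≤ 4 := by
    have e : 3 * taylorCoeff G 3 = taylorCoeff q 1 * taylorCoeff G 2 +
        taylorCoeff q 2 * taylorCoeff G 1 + taylorCoeff q 3 := by linear_combination g3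
    have := norm_add_le_of_le (norm_add_le_of_le (hmul nq1 nG2) (hmul nq2 nG1)) nq3
    rw [← e, norm_mul, Complex.norm_ofNat] at this
    linarith
  have nA2 : ‖A₂‖ ≤ 2 := by
    have := norm_add_le_of_le nG1 np1
    rw [← show (1 + 1) * A₂ = _ from f1, norm_mul] at this
    norm_num at this
    linarith
  have nA4 : ‖A₄‖ ≤ 4 := by
    have := norm_add_le_of_le
      (norm_add_le_of_le (norm_add_le_of_le nG3 (hmul np1 nG2)) (hmul np2 nG1)) np3
    rw [← show (3 + 1) * A₄ = _ from f3, norm_mul] at this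
    norm_num at this
    linarith
  -- The vector `(1, 0, -1)` is an eigenvector with eigenvalue `A₂ - A₄`, which splits off as a
  -- factor.
  have hdet : toeplitzDet f 3 2 = (A₂ - A₄) * (A₂ ^ 2 - 2 * A₃ ^ 2 + A₂ * A₄) := by
    have : toeplitzDet f 3 2 = Matrix.det !![A₂, A₃, A₄; A₃, A₂, A₃; A₄, A₃, A₂] := by
      rw [toeplitzDet]
      congr 1
      ext i j
      fin_cases i <;> fin_cases j <;> rfl
    rw [this, Matrix.det_fin_three]
    simp
    ring
  set l : ℂ := Real.cos α * Complex.exp (-(Complex.I * α)) with hldef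
  -- Both sides equal `cos² α`.
  have hl : ‖l‖ ^ 2 = l.re := by
    have e : -(Complex.I * (α : ℂ)) = ((-α : ℝ) : ℂ) * Complex.I := by push_cast; ring
    rw [hldef, e, norm_mul, Complex.norm_exp_ofReal_mul_I, Complex.re_ofReal_mul,
      Complex.exp_ofReal_mul_I_re, Real.cos_neg, mul_one, Complex.norm_real, Real.norm_eq_abs,
      sq_abs, sq]
  simp only [Real.cos_zero, Complex.ofReal_one, Complex.ofReal_zero, mul_zero, neg_zero,
    Complex.exp_zero, mul_one] at q1 q2 q3
  rw [hG1, q1, p1] at f1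
  rw [hG2, hG1, q1, q2, p1, p2] at f2
  rw [hG3, hG2, hG1, q1, q2, q3, p1, p2, p3] at f3
  have hQ := norm_quadratic_factor_le (a₂ := A₂) (a₃ := A₃) (a₄ := A₄) hl hs hs₁ hs₂ ht ht₁ ht₂
    (by linear_combination f1 / 2) (by linear_combination f2) (by linear_combination f3)
  have h6 : ‖A₂ - A₄‖ ≤ 2 + 4 := norm_sub_le_of_le nA2 nA4
  rw [hdet]
  have := hmul h6 hQ
  linarith
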